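/- Let $\mathcal D\subset\mathbb C\simeq\mathbb R^2$ be the deltoid domain, i.e. the connected component containing $0$ of the complement of the curve $\{\tfrac13(2e^{it}+e^{-2it}) : t\in\mathbb R\}$, and write $Z=x+iy$. For $\lambda\in\mathbb R$, let $\mathcal L^{(\lambda)}$ be the deltoid operator on $\mathcal D$, i.e. the second order differential operator without zeroth order term, acting on real functions $f$ by $$\mathcal L^{(\lambda)}f=\Gamma(x,x)\,\partial_{xx}f+2\,\Gamma(x,y)\,\partial_{xy}f+\Gamma(y,y)\,\partial_{yy}f-\lambda x\,\partial_xf-\lambda y\,\partial_yf ,$$ where the real coefficients $\Gamma(x,x),\Gamma(x,y),\Gamma(y,y)$ are determined by $$\Gamma(Z,Z)=\Gamma(x,x)-\Gamma(y,y)+2i\,\Gamma(x,y)=\bar Z-Z^2,\qquad \Gamma(Z,\bar Z)=\Gamma(x,x)+\Gamma(y,y)=\tfrac12(1-Z\bar Z).$$ Put $\Gamma(f,g)=\Gamma(x,x)\,\partial_xf\,\partial_xg+\Gamma(x,y)(\partial_xf\,\partial_yg+\partial_yf\,\partial_xg)+\Gamma(y,y)\,\partial_yf\,\partial_yg$ and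 $$\Gamma_2(f,g)=\tfrac12\big(\mathcal L^{(\lambda)}\Gamma(f,g)-\Gamma(f,\mathcal L^{(\lambda)}g)-\Gamma(g,\mathcal L^{(\lambda)}f)\big).$$ For $\rho\in\mathbb R$ and $n\in[1,\infty]$, say that $\mathcal L^{(\lambda)}$ satisfies $CD(\rho,n)$ if, for every real function $f$ that is $C^\infty$ in a neighbourhood of $\overline{\mathcal D}$, one has on $\mathcal D$ $$\Gamma_2(f,f)\ \ge\ \rho\,\Gamma(f,f)+\tfrac1n\big(\mathcal L^{(\lambda)}f\big)^2\qquad(\text{with }\tfrac1\infty=0).$$ 1. If $\lambda<1$, then $\mathcal L^{(\lambda)}$ satisfies $CD(\rho,\infty)$ for no $\rho\in\mathbb R$. 2. If $\lambda>1$, then $\mathcal L^{(\lambda)}$ satisfies $CD(\rho,n)$ for no $\rho\in\mathbb R$ and no $n\in[1,2\lambda)$. Moreover, the best constant $\rho$ in the $CD(\rho,2\lambda)$ inequality is $\rho=\tfrac{3(\lambda-1)}4$: the inequality $CD\big(\tfrac{3(\lambda-1)}4,2\lambda\big)$ holds, and $CD(\rho,2\lambda)$ fails for every $\rho>\tfrac{3(\lambda-1)}4$.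 -/

import Mathlib

open scoped ENNReal ContDiff ComplexConjugate

noncomputable section

namespace Deltoid

/-- The deltoid curve, scaled by the factor `1/3`: the image of
`t ↦ (2 exp (i t) + exp (-2 i t)) / 3`. -/
def curve : Set ℂ :=
  Set.range fun t : ℝ =>
    (2 * Complex.exp (t * Complex.I) + Complex.exp (-(2 * t * Complex.I))) / 3

/-- The deltoid domain: the connected component of `0` in the complement of the curve. -/
def domain : Set ℂ := connectedComponentIn curveᶜ 0

/-- The algebra of test functions: real functions that are smooth on some neighbourhood of the
closed deltoid domain (their values away from this neighbourhood play no role). -/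
def IsTest (f : ℂ → ℝ) : Prop :=
  ∃ U : Set ℂ, IsOpen U ∧ closure domain ⊆ U ∧ ContDiffOn ℝ ∞ f U

/-- The partial derivative in `x`, where `Z = x + i y`. -/
def dx (f : ℂ → ℝ) (z : ℂ) : ℝ := fderiv ℝ f z 1

/-- The partial derivative in `y`, where `Z = x + i y`. -/
def dy (f : ℂ → ℝ) (z : ℂ) : ℝ := fderiv ℝ f z Complex.I

/-- `Γ(Z, Z) = conj Z - Z ^ 2`, which is `Γ(x, x) - Γ(y, y) + 2 i Γ(x, y)`. -/
def gammaZZ (z : ℂ) : ℂ := conj z - z ^ 2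

/-- `Γ(Z, conj Z) = (1 - Z conj Z) / 2`, which is `Γ(x, x) + Γ(y, y)`. -/
def gammaZZbar (z : ℂ) : ℝ := (1 - Complex.normSq z) / 2

/-- The coefficient `Γ(x, x)`. -/
def gxx (z : ℂ) : ℝ := (gammaZZbar z + (gammaZZ z).re) / 2

/-- The coefficient `Γ(x, y)`. -/
def gxy (z : ℂ) : ℝ := (gammaZZ z).im / 2

/-- The coefficient `Γ(y, y)`. -/
def gyy (z : ℂ) : ℝ := (gammaZZbar z - (gammaZZ z).re) / 2

/-- The carré du champ operator `Γ(f, g)` of the deltoid model. -/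
def Gam (f g : ℂ → ℝ) (z : ℂ) : ℝ :=
  gxx z * (dx f z * dx g z) + gxy z * (dx f z * dy g z + dy f z * dx g z)
    + gyy z * (dy f z * dy g z)

/-- The deltoid operator with parameter `l`: the second order operator without zeroth order term
whose carré du champ is `Γ` and for which `L Z = - l Z`, that is `L x = - l x`, `L y = - l y`. -/
def L (l : ℝ) (f : ℂ → ℝ) (z : ℂ) : ℝ :=
  gxx z * dx (dx f) z + 2 * gxy z * dx (dy f) z + gyy z * dy (dy f) z
    - l * z.re * dx f z - l * z.im * dy f z

/-- The iterated carré du champ operator `Γ₂(f, g)`. -/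
def Gam2 (l : ℝ) (f g : ℂ → ℝ) (z : ℂ) : ℝ :=
  (L l (Gam f g) z - Gam f (L l g) z - Gam g (L l f) z) / 2

/-- The curvature-dimension inequality `CD(ρ, n)` for the deltoid operator with parameter `l`,
meaningful for `n ∈ [1, ∞]`; for `n = ∞` the coefficient `1 / n` is `0`. -/
def CD (l ρ : ℝ) (n : ℝ≥0∞) : Prop :=
  ∀ f : ℂ → ℝ, IsTest f → ∀ z ∈ domain,
    ρ * Gam f f z + (n⁻¹).toReal * (L l f z) ^ 2 ≤ Gam2 l f f z

end Deltoid

end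

namespace Deltoid

section Calculus

variable {U : Set ℂ} {f g h : ℂ → ℝ} {z : ℂ}

/-- The derivative of `f` in the constant direction `v`. -/
noncomputable def pd (v : ℂ) (f : ℂ → ℝ) (z : ℂ) : ℝ := fderiv ℝ f z v

lemma dx_eq_pd : dx = pd 1 := rfl

lemma dy_eq_pd : dy = pd Complex.I := rfl

lemma differentiableAt_of_smoothOn (hU : IsOpen U) (hf : ContDiffOn ℝ ∞ f U) (hz : z ∈ U) :
    DifferentiableAt ℝ f z :=
  (hf.contDiffAt (hU.mem_nhds hz)).differentiableAt (by simp)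

lemma smoothOn_pd (hU : IsOpen U) (v : ℂ) (hf : ContDiffOn ℝ ∞ f U) :
    ContDiffOn ℝ ∞ (pd v f) U :=
  (hf.fderiv_of_isOpen hU (m := ∞) (by simp)).clm_apply contDiffOn_const

lemma pd_congr (hU : IsOpen U) (v : ℂ) (hfg : Set.EqOn f g U) (hz : z ∈ U) :
    pd v f z = pd v g z := by
  unfold pd
  rw [(hfg.eventuallyEq_of_mem (hU.mem_nhds hz)).fderiv_eq]

lemma pd_add (hU : IsOpen U) (v : ℂ) (hf : ContDiffOn ℝ ∞ f U) (hg : ContDiffOn ℝ ∞ g U)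
    (hz : z ∈ U) : pd v (fun w => f w + g w) z = pd v f z + pd v g z := by
  unfold pd
  rw [fderiv_fun_add (differentiableAt_of_smoothOn hU hf hz)
    (differentiableAt_of_smoothOn hU hg hz)]
  rfl

lemma pd_mul (hU : IsOpen U) (v : ℂ) (hf : ContDiffOn ℝ ∞ f U) (hg : ContDiffOn ℝ ∞ g U)
    (hz : z ∈ U) : pd v (fun w => f w * g w) z = pd v f z * g z + f z * pd v g z := by
  unfold pd
  rw [fderiv_fun_mul (differentiableAt_of_smoothOn hU hf hz)
    (differentiableAt_of_smoothOn hU hg hz)]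
  simp only [add_apply, smul_apply, smul_eq_mul]
  ring

lemma pd_pd_add (hU : IsOpen U) (u v : ℂ) (hf : ContDiffOn ℝ ∞ f U) (hg : ContDiffOn ℝ ∞ g U)
    (hz : z ∈ U) : pd u (pd v fun w => f w + g w) z = pd u (pd v f) z + pd u (pd v g) z := by
  rw [pd_congr hU u (fun w hw => pd_add hU v hf hg hw) hz,
    pd_add hU u (smoothOn_pd hU v hf) (smoothOn_pd hU v hg) hz]

lemma pd_pd_mul (hU : IsOpen U) (u v : ℂ) (hf : ContDiffOn ℝ ∞ f U) (hg : ContDiffOn ℝ ∞ g U)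
    (hz : z ∈ U) :
    pd u (pd v fun w => f w * g w) z =
      pd u (pd v f) z * g z + pd v f z * pd u g z + pd u f z * pd v g z
        + f z * pd u (pd v g) z := by
  have hf' := smoothOn_pd hU v hf
  have hg' := smoothOn_pd hU v hg
  rw [pd_congr hU u (fun w hw => pd_mul hU v hf hg hw) hz,
    pd_add hU u (hf'.mul hg) (hf.mul hg') hz, pd_mul hU u hf' hg hz, pd_mul hU u hf hg' hz]
  ring

lemma pd_comm (hU : IsOpen U) (u v : ℂ) (hf : ContDiffOn ℝ ∞ f U) (hz : z ∈ U) :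
    pd u (pd v f) z = pd v (pd u f) z := by
  have hc := hf.contDiffAt (hU.mem_nhds hz)
  have hd : DifferentiableAt ℝ (fderiv ℝ f) z :=
    (hc.fderiv_right (m := 1) (WithTop.coe_le_coe.2 le_top)).differentiableAt (by simp)
  have key : ∀ a b : ℂ, pd a (pd b f) z = fderiv ℝ (fderiv ℝ f) z a b := by
    intro a b
    have : pd b f = fun w => fderiv ℝ f w b := rfl
    rw [this, pd, fderiv_clm_apply hd (differentiableAt_const b)]
    simp
  rw [key, key]
  have h2 : (2 : WithTop ℕ∞) ≤ ((⊤ : ℕ∞) : WithTop ℕ∞) :=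
    WithTop.coe_le_coe.2 (le_top (a := (2 : ℕ∞)))
  exact (hc.isSymmSndFDerivAt (by simpa using h2)).eq u v

lemma Gam_mul_right (hU : IsOpen U) (hg : ContDiffOn ℝ ∞ g U) (hh : ContDiffOn ℝ ∞ h U)
    (hz : z ∈ U) : Gam f (fun w => g w * h w) z = g z * Gam f h z + h z * Gam f g z := by
  simp only [Gam, dx_eq_pd, dy_eq_pd, pd_mul hU _ hg hh hz]
  ring

lemma L_add (hU : IsOpen U) (l : ℝ) (hf : ContDiffOn ℝ ∞ f U) (hg : ContDiffOn ℝ ∞ g U)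
    (hz : z ∈ U) : L l (fun w => f w + g w) z = L l f z + L l g z := by
  simp only [L, dx_eq_pd, dy_eq_pd, pd_pd_add hU _ _ hf hg hz, pd_add hU _ hf hg hz]
  ring

lemma L_mul (hU : IsOpen U) (l : ℝ) (hf : ContDiffOn ℝ ∞ f U) (hg : ContDiffOn ℝ ∞ g U)
    (hz : z ∈ U) :
    L l (fun w => f w * g w) z = f z * L l g z + g z * L l f z + 2 * Gam f g z := by
  have h1 := pd_comm hU 1 Complex.I hf hz
  have h2 := pd_comm hU 1 Complex.I hg hz
  simp only [L, Gam, dx_eq_pd, dy_eq_pd, pd_pd_mul hU _ _ hf hg hz, pd_mul hU _ hf hg hz]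
  ring

end Calculus

section Coefficients

lemma gxx_eq (z : ℂ) : gxx z = (1 + 2 * z.re - 3 * z.re ^ 2 + z.im ^ 2) / 4 := by
  simp [gxx, gammaZZ, gammaZZbar, Complex.normSq_apply, pow_two]; ring

lemma gxy_eq (z : ℂ) : gxy z = -(z.im + 2 * z.re * z.im) / 2 := by
  simp [gxy, gammaZZ, pow_two]; ring

lemma gyy_eq (z : ℂ) : gyy z = (1 - 2 * z.re + z.re ^ 2 - 3 * z.im ^ 2) / 4 := by
  simp [gyy, gammaZZ, gammaZZbar, Complex.normSq_apply, pow_two]; ring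

/-- The real polynomial of degree two in `x`, `y` with the given coefficients. -/
def quad (c d e a b k : ℝ) (z : ℂ) : ℝ :=
  c + d * z.re + e * z.im + a * z.re ^ 2 + b * (z.re * z.im) + k * z.im ^ 2

variable (c d e a b k : ℝ)

lemma contDiff_re : ContDiff ℝ ∞ Complex.re := Complex.reCLM.contDiff

lemma contDiff_im : ContDiff ℝ ∞ Complex.im := Complex.imCLM.contDiff

lemma contDiff_quad : ContDiff ℝ ∞ (quad c d e a b k) := by
  have h1 := contDiff_re
  have h2 := contDiff_im
  unfold quad
  fun_prop

lemma pd_quad (v z : ℂ) : pd v (quad c d e a b k) z =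
    d * v.re + e * v.im + a * (2 * z.re * v.re) + b * (v.re * z.im + z.re * v.im)
      + k * (2 * z.im * v.im) := by
  have h1 : HasFDerivAt Complex.re Complex.reCLM z := Complex.reCLM.hasFDerivAt
  have h2 : HasFDerivAt Complex.im Complex.imCLM z := Complex.imCLM.hasFDerivAt
  have h := (((((h1.const_mul d).const_add c).add (h2.const_mul e)).add
    ((h1.pow 2).const_mul a)).add ((h1.mul h2).const_mul b)).add ((h2.pow 2).const_mul k)
  have h' : HasFDerivAt (quad c d e a b k) _ z := h
  rw [pd, h'.fderiv]
  simp
  ring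

lemma dx_quad : dx (quad c d e a b k) = quad d (2 * a) b 0 0 0 := by
  ext z; rw [dx_eq_pd, pd_quad]; simp [quad]; ring

lemma dy_quad : dy (quad c d e a b k) = quad e b (2 * k) 0 0 0 := by
  ext z; rw [dy_eq_pd, pd_quad]; simp [quad]; ring

lemma gxx_eq_quad : gxx = quad (1 / 4) (1 / 2) 0 (-3 / 4) 0 (1 / 4) := by
  ext z; rw [gxx_eq, quad]; ring

lemma gxy_eq_quad : gxy = quad 0 0 (-1 / 2) 0 (-1) 0 := by
  ext z; rw [gxy_eq, quad]; ring

lemma gyy_eq_quad : gyy = quad (1 / 4) (-1 / 2) 0 (1 / 4) 0 (-3 / 4) := by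
  ext z; rw [gyy_eq, quad]; ring

end Coefficients

section Jet

/-- The value of `Γ₂(f, f)` at `x + i y`, as a quadratic form in the first derivatives `p, q` and
the second derivatives `a, b, c` of `f`. -/
noncomputable def jetGam2 (l x y p q a b c : ℝ) : ℝ :=
  let A := (1 + 2 * x - 3 * x ^ 2 + y ^ 2) / 4
  let B := -(y + 2 * x * y) / 2
  let C := (1 - 2 * x + x ^ 2 - 3 * y ^ 2) / 4
  ((A * (-3 / 2) + C / 2 - l * (x * (1 - 3 * x) + y * y) / 2) * p ^ 2
    + 2 * (-2 * B + l * (2 * x * y + y / 2)) * (p * q)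
    + (A / 2 - C * (3 / 2) - l * (x * (x - 1) - 3 * y ^ 2) / 2) * q ^ 2) / 2
  + (A * (A * a ^ 2 + 2 * B * (a * b) + C * b ^ 2)
    + 2 * B * (A * (a * b) + B * (a * c + b ^ 2) + C * (b * c))
    + C * (A * b ^ 2 + 2 * B * (b * c) + C * c ^ 2))
  + 2 * (((1 - 3 * x) / 2 * (A * a + B * b) + y / 2 * (B * a + C * b)) * p
    + (-y * (A * a + B * b) - (1 + 2 * x) / 2 * (B * a + C * b)) * q
    + (-y * (A * b + B * c) - (1 + 2 * x) / 2 * (B * b + C * c)) * p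
    + ((x - 1) / 2 * (A * b + B * c) - 3 / 2 * y * (B * b + C * c)) * q)
  - ((A * p + B * q) * ((1 - 3 * x) / 2 * a - 2 * y * b + (x - 1) / 2 * c)
    + (B * p + C * q) * (y / 2 * a - (1 + 2 * x) * b - 3 / 2 * y * c))
  + l * (A * p ^ 2 + 2 * B * (p * q) + C * q ^ 2)

variable {U : Set ℂ} {f : ℂ → ℝ} {z : ℂ}

lemma Gam2_eq_jetGam2 (hU : IsOpen U) (l : ℝ) (hf : ContDiffOn ℝ ∞ f U) (hz : z ∈ U) :
    Gam2 l f f z = jetGam2 l z.re z.im (dx f z) (dy f z)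
      (dx (dx f) z) (dx (dy f) z) (dy (dy f) z) := by
  have hq : ∀ c d e a b k : ℝ, ContDiffOn ℝ ∞ (quad c d e a b k) U :=
    fun c d e a b k => (contDiff_quad c d e a b k).contDiffOn
  have hx : ContDiffOn ℝ ∞ (dx f) U := smoothOn_pd hU 1 hf
  have hy : ContDiffOn ℝ ∞ (dy f) U := smoothOn_pd hU Complex.I hf
  have hxx : ContDiffOn ℝ ∞ (dx (dx f)) U := smoothOn_pd hU 1 hx
  have hxy : ContDiffOn ℝ ∞ (dx (dy f)) U := smoothOn_pd hU 1 hy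
  have hyy : ContDiffOn ℝ ∞ (dy (dy f)) U := smoothOn_pd hU Complex.I hy
  have s1 : Set.EqOn (dy (dx f)) (dx (dy f)) U := fun w hw => pd_comm hU Complex.I 1 hf hw
  have t1 : dx (dy (dx f)) z = dx (dx (dy f)) z := pd_congr hU 1 s1 hz
  have t2 : dy (dy (dx f)) z = dx (dy (dy f)) z :=
    (pd_congr hU Complex.I s1 hz).trans (pd_comm hU Complex.I 1 hy hz)
  have t3 : dy (dx (dx f)) z = dx (dx (dy f)) z :=
    (pd_comm hU Complex.I 1 hx hz).trans t1
  have t4 : dy (dx (dy f)) z = dx (dy (dy f)) z := pd_comm hU Complex.I 1 hy hz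
  have e1 : Gam f f = fun w =>
      (gxx w * (dx f w * dx f w) + (2 * gxy w) * (dx f w * dy f w))
        + gyy w * (dy f w * dy f w) := by
    ext w; simp only [Gam]; ring
  have e2 : L l f = fun w =>
      (((gxx w * dx (dx f) w + (2 * gxy w) * dx (dy f) w) + gyy w * dy (dy f) w)
        + (-l * w.re) * dx f w) + (-l * w.im) * dy f w := by
    ext w; simp only [L]; ring
  have q1 : (fun w : ℂ => 2 * gxy w) = quad 0 0 (-1) 0 (-2) 0 := by
    ext w; rw [gxy_eq, quad]; ring
  have q2 : (fun w : ℂ => -l * w.re) = quad 0 (-l) 0 0 0 0 := by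
    ext w; rw [quad]; ring
  have q3 : (fun w : ℂ => -l * w.im) = quad 0 0 (-l) 0 0 0 := by
    ext w; rw [quad]; ring
  have q1' := fun w => congrFun q1 w
  have q2' := fun w => congrFun q2 w
  have q3' := fun w => congrFun q3 w
  have k1 : L l (Gam f f) z =
      ((gxx z * (2 * (dx f z * L l (dx f) z) + 2 * Gam (dx f) (dx f) z)
          + dx f z * dx f z * L l gxx z + 4 * (dx f z * Gam gxx (dx f) z))
      + (2 * gxy z * (dx f z * L l (dy f) z + dy f z * L l (dx f) z + 2 * Gam (dx f) (dy f) z)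
          + dx f z * dy f z * L l (quad 0 0 (-1) 0 (-2) 0) z
          + 2 * (dx f z * Gam (quad 0 0 (-1) 0 (-2) 0) (dy f) z
            + dy f z * Gam (quad 0 0 (-1) 0 (-2) 0) (dx f) z)))
      + (gyy z * (2 * (dy f z * L l (dy f) z) + 2 * Gam (dy f) (dy f) z)
          + dy f z * dy f z * L l gyy z + 4 * (dy f z * Gam gyy (dy f) z)) := by
    rw [e1, q1', gxx_eq_quad, gyy_eq_quad]
    simp only [q1']
    rw [L_add hU l (((hq _ _ _ _ _ _).mul (hx.mul hx)).add ((hq _ _ _ _ _ _).mul (hx.mul hy)))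
      ((hq _ _ _ _ _ _).mul (hy.mul hy)) hz,
      L_add hU l ((hq _ _ _ _ _ _).mul (hx.mul hx)) ((hq _ _ _ _ _ _).mul (hx.mul hy)) hz,
      L_mul hU l (hq _ _ _ _ _ _) (hx.mul hx) hz, L_mul hU l (hq _ _ _ _ _ _) (hx.mul hy) hz,
      L_mul hU l (hq _ _ _ _ _ _) (hy.mul hy) hz, L_mul hU l hx hx hz, L_mul hU l hx hy hz,
      L_mul hU l hy hy hz, Gam_mul_right hU hx hx hz, Gam_mul_right hU hx hy hz,
      Gam_mul_right hU hy hy hz]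
    ring
  have k2 : ∀ v, pd v (L l f) z =
      (((pd v gxx z * dx (dx f) z + gxx z * pd v (dx (dx f)) z)
      + (pd v (quad 0 0 (-1) 0 (-2) 0) z * dx (dy f) z + 2 * gxy z * pd v (dx (dy f)) z)
      + (pd v gyy z * dy (dy f) z + gyy z * pd v (dy (dy f)) z))
      + (pd v (quad 0 (-l) 0 0 0 0) z * dx f z + -l * z.re * pd v (dx f) z))
      + (pd v (quad 0 0 (-l) 0 0 0) z * dy f z + -l * z.im * pd v (dy f) z) := by
    intro v
    rw [e2, q1', q2', q3', gxx_eq_quad, gyy_eq_quad]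
    simp only [q1', q2', q3']
    have m1 := (hq (1 / 4) (1 / 2) 0 (-3 / 4) 0 (1 / 4)).mul hxx
    have m2 := (hq 0 0 (-1) 0 (-2) 0).mul hxy
    have m3 := (hq (1 / 4) (-1 / 2) 0 (1 / 4) 0 (-3 / 4)).mul hyy
    have m4 := (hq 0 (-l) 0 0 0 0).mul hx
    have m5 := (hq 0 0 (-l) 0 0 0).mul hy
    rw [pd_add hU v (((m1.add m2).add m3).add m4) m5 hz, pd_add hU v ((m1.add m2).add m3) m4 hz,
      pd_add hU v (m1.add m2) m3 hz, pd_add hU v m1 m2 hz,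
      pd_mul hU v (hq _ _ _ _ _ _) hxx hz, pd_mul hU v (hq _ _ _ _ _ _) hxy hz,
      pd_mul hU v (hq _ _ _ _ _ _) hyy hz, pd_mul hU v (hq _ _ _ _ _ _) hx hz,
      pd_mul hU v (hq _ _ _ _ _ _) hy hz]
  have k3 : Gam f (L l f) z =
      (gxx z * dx f z + gxy z * dy f z) * pd 1 (L l f) z
        + (gxy z * dx f z + gyy z * dy f z) * pd Complex.I (L l f) z := by
    simp only [Gam, dx_eq_pd, dy_eq_pd]; ring
  rw [Gam2, k3, k1, k2, k2, ← dx_eq_pd, ← dy_eq_pd]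
  simp only [L, Gam, s1 hz, t1, t2, t3, t4, gxx_eq_quad, gxy_eq_quad, gyy_eq_quad, dx_quad,
    dy_quad]
  simp only [quad, jetGam2]
  ring

/-- The value of `L f` at `x + i y` in terms of the derivatives of `f`. -/
noncomputable def jetL (l x y p q a b c : ℝ) : ℝ :=
  (1 + 2 * x - 3 * x ^ 2 + y ^ 2) / 4 * a - (y + 2 * x * y) * b
    + (1 - 2 * x + x ^ 2 - 3 * y ^ 2) / 4 * c - l * (x * p + y * q)

lemma L_eq_jetL (l : ℝ) (f : ℂ → ℝ) (z : ℂ) :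
    L l f z = jetL l z.re z.im (dx f z) (dy f z) (dx (dx f) z) (dx (dy f) z) (dy (dy f) z) := by
  rw [L, jetL, gxx_eq, gxy_eq, gyy_eq]; ring

end Jet

section Algebra

/-- For a positive definite matrix with entries `A, B, C` and a symmetric matrix with entries
`h, k, m`, the discriminant of the relative characteristic polynomial is nonnegative. -/
lemma four_mul_det_mul_det_le_sq {A B C : ℝ} (hA : 0 < A) (hD : 0 ≤ A * C - B ^ 2)
    (h k m : ℝ) :
    4 * (A * C - B ^ 2) * (h * m - k ^ 2) ≤ (h * C - 2 * k * B + m * A) ^ 2 := by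
  have e : A ^ 2 * ((h * C - 2 * k * B + m * A) ^ 2 - 4 * (A * C - B ^ 2) * (h * m - k ^ 2)) =
      (A * (m * A - h * C) - 2 * B * (k * A - h * B)) ^ 2
        + 4 * (A * C - B ^ 2) * (k * A - h * B) ^ 2 := by ring
  have h1 : 0 ≤ A ^ 2 *
      ((h * C - 2 * k * B + m * A) ^ 2 - 4 * (A * C - B ^ 2) * (h * m - k ^ 2)) := by
    rw [e]; positivity
  have := nonneg_of_mul_nonneg_right h1 (by positivity)
  linarith

/-- Lower bound for `Γ₂` by the trace of the Hessian of the flat metric and the drift term. -/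
lemma sq_jetL_one_le_jetGam2 {l x y : ℝ} (p q a b c : ℝ)
    (hA : 0 < (1 + 2 * x - 3 * x ^ 2 + y ^ 2) / 4)
    (hD : 0 < (1 + 2 * x - 3 * x ^ 2 + y ^ 2) / 4 * ((1 - 2 * x + x ^ 2 - 3 * y ^ 2) / 4)
      - (-(y + 2 * x * y) / 2) ^ 2) :
    jetL 1 x y p q a b c ^ 2 / 2
      + (l - 1) * ((1 + x) / 4 * p ^ 2 - y / 2 * (p * q) + (1 - x) / 4 * q ^ 2)
      ≤ jetGam2 l x y p q a b c := by
  obtain ⟨A, eA⟩ : ∃ A, A = (1 + 2 * x - 3 * x ^ 2 + y ^ 2) / 4 := ⟨_, rfl⟩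
  obtain ⟨B, eB⟩ : ∃ B, B = -(y + 2 * x * y) / 2 := ⟨_, rfl⟩
  obtain ⟨C, eC⟩ : ∃ C, C = (1 - 2 * x + x ^ 2 - 3 * y ^ 2) / 4 := ⟨_, rfl⟩
  obtain ⟨h, eh⟩ : ∃ h, h = A ^ 2 * a + 2 * A * B * b + B ^ 2 * c
      + (A * (1 - 3 * x) / 2 + B * y / 2) / 2 * p
      + (-A * y - B * (1 + 2 * x) / 2 - (B * (1 - 3 * x) / 2 + C * y / 2) / 2) * q := ⟨_, rfl⟩
  obtain ⟨k, ek⟩ : ∃ k, k = A * B * a + (A * C + B ^ 2) * b + B * C * c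
      + (B * (1 - 3 * x) / 2 + C * y / 2) / 2 * p
      + (A * (x - 1) / 2 - B * (3 / 2 * y)) / 2 * q := ⟨_, rfl⟩
  obtain ⟨m, em⟩ : ∃ m, m = B ^ 2 * a + 2 * B * C * b + C ^ 2 * c
      + (-B * y - C * (1 + 2 * x) / 2 - (A * (x - 1) / 2 - B * (3 / 2 * y)) / 2) * p
      + (B * (x - 1) / 2 - C * (3 / 2 * y)) / 2 * q := ⟨_, rfl⟩
  have htr : (A * C - B ^ 2) * jetL 1 x y p q a b c = h * C - 2 * k * B + m * A := by
    rw [eh, ek, em, eA, eB, eC, jetL]; ring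
  have hdet : (A * C - B ^ 2) * (jetGam2 l x y p q a b c
      - (l - 1) * ((1 + x) / 4 * p ^ 2 - y / 2 * (p * q) + (1 - x) / 4 * q ^ 2)) =
      (A * C - B ^ 2) * jetL 1 x y p q a b c ^ 2 - 2 * (h * m - k ^ 2) := by
    rw [eh, ek, em, eA, eB, eC, jetL, jetGam2]; ring
  rw [← eA] at hA
  rw [← eA, ← eB, ← eC] at hD
  have hle := four_mul_det_mul_det_le_sq hA hD.le h k m
  rw [← htr] at hle
  have h1 : 4 * (h * m - k ^ 2) ≤ (A * C - B ^ 2) * jetL 1 x y p q a b c ^ 2 := by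
    refine le_of_mul_le_mul_left ?_ hD
    linarith
  have h2 : 0 ≤ (A * C - B ^ 2) * (jetGam2 l x y p q a b c
      - (l - 1) * ((1 + x) / 4 * p ^ 2 - y / 2 * (p * q) + (1 - x) / 4 * q ^ 2)
      - jetL 1 x y p q a b c ^ 2 / 2) := by
    linarith
  have := nonneg_of_mul_nonneg_right h2 hD
  linarith

/-- The curvature-dimension inequality at the level of jets. -/
lemma curvatureDimension_jet {l x y : ℝ} (hl : 1 < l) (p q a b c : ℝ)
    (hA : 0 < (1 + 2 * x - 3 * x ^ 2 + y ^ 2) / 4)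
    (hD : 0 < (1 + 2 * x - 3 * x ^ 2 + y ^ 2) / 4 * ((1 - 2 * x + x ^ 2 - 3 * y ^ 2) / 4)
      - (-(y + 2 * x * y) / 2) ^ 2) :
    3 * (l - 1) / 4 * ((1 + 2 * x - 3 * x ^ 2 + y ^ 2) / 4 * p ^ 2 - (y + 2 * x * y) * (p * q)
        + (1 - 2 * x + x ^ 2 - 3 * y ^ 2) / 4 * q ^ 2)
      + (2 * l)⁻¹ * jetL l x y p q a b c ^ 2 ≤ jetGam2 l x y p q a b c := by
  refine le_trans ?_ (sq_jetL_one_le_jetGam2 p q a b c hA hD)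
  obtain ⟨A, eA⟩ : ∃ A, A = (1 + 2 * x - 3 * x ^ 2 + y ^ 2) / 4 := ⟨_, rfl⟩
  obtain ⟨B, eB⟩ : ∃ B, B = -(y + 2 * x * y) / 2 := ⟨_, rfl⟩
  obtain ⟨C, eC⟩ : ∃ C, C = (1 - 2 * x + x ^ 2 - 3 * y ^ 2) / 4 := ⟨_, rfl⟩
  obtain ⟨s, es⟩ : ∃ s, s = jetL 1 x y p q a b c := ⟨_, rfl⟩
  have hs : jetL l x y p q a b c = s - (l - 1) * (x * p + y * q) := by
    rw [es, jetL, jetL]; ring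
  have hadj : 0 ≤ C * p ^ 2 - 2 * B * (p * q) + A * q ^ 2 := by
    rw [← eA] at hA
    rw [← eA, ← eB, ← eC] at hD
    have e : A * (C * p ^ 2 - 2 * B * (p * q) + A * q ^ 2) =
      (A * q - B * p) ^ 2 + (A * C - B ^ 2) * p ^ 2 := by ring
    refine nonneg_of_mul_nonneg_right ?_ hA
    rw [e]; positivity
  have e1 : s ^ 2 / 2 + (l - 1) * ((1 + x) / 4 * p ^ 2 - y / 2 * (p * q) + (1 - x) / 4 * q ^ 2)
      = 3 * (l - 1) / 4 * ((1 + 2 * x - 3 * x ^ 2 + y ^ 2) / 4 * p ^ 2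
        - (y + 2 * x * y) * (p * q) + (1 - 2 * x + x ^ 2 - 3 * y ^ 2) / 4 * q ^ 2)
      + (2 * l)⁻¹ * (s - (l - 1) * (x * p + y * q)) ^ 2
      + ((l - 1) / 4 * (C * p ^ 2 - 2 * B * (p * q) + A * q ^ 2)
        + (l - 1) / (2 * l) * (s + (x * p + y * q)) ^ 2) := by
    rw [eA, eB, eC]
    have : l ≠ 0 := by positivity
    field_simp
    ring
  have hl1 : 0 < l - 1 := by linarith
  have h3 : 0 ≤ (l - 1) / 4 * (C * p ^ 2 - 2 * B * (p * q) + A * q ^ 2)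
        + (l - 1) / (2 * l) * (s + (x * p + y * q)) ^ 2 := by positivity
  rw [hs, ← es, e1]
  linarith

end Algebra

section Domain

/-- The determinant of the matrix of coefficients `Γ`. -/
noncomputable def gdet (z : ℂ) : ℝ := gxx z * gyy z - gxy z ^ 2

lemma gdet_eq (z : ℂ) : gdet z = (1 + 2 * z.re - 3 * z.re ^ 2 + z.im ^ 2) / 4 *
    ((1 - 2 * z.re + z.re ^ 2 - 3 * z.im ^ 2) / 4) - (-(z.im + 2 * z.re * z.im) / 2) ^ 2 := by
  rw [gdet, gxx_eq, gyy_eq, gxy_eq]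

lemma continuous_gdet : Continuous gdet := by
  have h : gdet = fun z => gxx z * gyy z - gxy z ^ 2 := rfl
  rw [h, gxx_eq_quad, gyy_eq_quad, gxy_eq_quad]
  have := fun c d e a b k => (contDiff_quad c d e a b k).continuous
  exact ((this _ _ _ _ _ _).mul (this _ _ _ _ _ _)).sub ((this _ _ _ _ _ _).pow 2)

lemma sixteen_mul_gdet (z : ℂ) : ((16 * gdet z : ℝ) : ℂ) =
    (1 - z * conj z) ^ 2 - 4 * (conj z - z ^ 2) * (z - conj z ^ 2) := by
  rw [gdet_eq]
  apply Complex.ext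
  · simp only [Complex.ofReal_re]
    simp [pow_two]
    ring
  · simp only [Complex.ofReal_im]
    simp [pow_two]
    ring

lemma mem_curve_of_unit {u z : ℂ} (hu : u * conj u = 1) (hz : 3 * z = 2 * u + conj u ^ 2) :
    z ∈ curve := by
  have hn : ‖u‖ = 1 := by
    have h1 : Complex.normSq u = 1 := by
      have := Complex.mul_conj u
      rw [hu] at this
      exact_mod_cast this.symm
    rw [Complex.norm_def, h1, Real.sqrt_one]
  have he : Complex.exp (u.arg * Complex.I) = u := by
    have := Complex.norm_mul_exp_arg_mul_I u
    rwa [hn, Complex.ofReal_one, one_mul] at this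
  have he' : Complex.exp (-(2 * u.arg * Complex.I)) = conj u ^ 2 := by
    have h0 : conj u = Complex.exp (-(u.arg * Complex.I)) := by
      rw [Complex.exp_neg, he]
      exact (inv_eq_of_mul_eq_one_right hu).symm
    rw [h0, ← Complex.exp_nat_mul]
    congr 1
    push_cast
    ring
  refine ⟨u.arg, ?_⟩
  simp only
  rw [he, he', ← hz]
  ring

/-- The degeneracy locus of `Γ` is contained in the deltoid curve. -/
lemma mem_curve_of_gdet_eq_zero {z : ℂ} (h : gdet z = 0) : z ∈ curve := by
  have hD := sixteen_mul_gdet z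
  rw [h, mul_zero, Complex.ofReal_zero] at hD
  by_cases hk : 1 - z * conj z = 0
  · have hzz : conj z = z ^ 2 ∨ z = conj z ^ 2 := by
      rw [hk] at hD
      have : (conj z - z ^ 2) * (z - conj z ^ 2) = 0 := by linear_combination (1 / 4) * hD
      rcases mul_eq_zero.1 this with h | h
      · exact Or.inl (sub_eq_zero.1 h)
      · exact Or.inr (sub_eq_zero.1 h)
    have hz : z = conj z ^ 2 := by
      rcases hzz with h | h
      · have := congrArg conj h
        simpa using this
      · exact h
    refine mem_curve_of_unit (u := z) ?_ ?_
    · linear_combination -hk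
    · linear_combination hz
  · have hc : conj (2 * (z - conj z ^ 2) / (1 - z * conj z)) =
        2 * (conj z - z ^ 2) / (1 - z * conj z) := by
      simp [mul_comm, Complex.conj_ofNat]
    refine mem_curve_of_unit (u := 2 * (z - conj z ^ 2) / (1 - z * conj z)) ?_ ?_
    · rw [hc]
      field_simp
      linear_combination hD
    · rw [hc]
      field_simp
      linear_combination (z) * hD

/-- The determinant of `Γ` vanishes on the deltoid curve. -/
lemma gdet_eq_zero_of_mem_curve {z : ℂ} (h : z ∈ curve) : gdet z = 0 := by
  obtain ⟨t, rfl⟩ := h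
  obtain ⟨u, hu⟩ : ∃ u, u = Complex.exp (t * Complex.I) := ⟨_, rfl⟩
  have hu0 : u ≠ 0 := hu ▸ Complex.exp_ne_zero _
  have hcu : conj u = u⁻¹ := by
    rw [hu, ← Complex.exp_conj, ← Complex.exp_neg]
    simp
  have he : Complex.exp (-(2 * t * Complex.I)) = (u⁻¹) ^ 2 := by
    rw [hu, ← Complex.exp_neg, ← Complex.exp_nat_mul]
    congr 1
    push_cast
    ring
  simp only
  rw [he, ← hu]
  have hD := sixteen_mul_gdet ((2 * u + u⁻¹ ^ 2) / 3)
  have : (1 - (2 * u + u⁻¹ ^ 2) / 3 * conj ((2 * u + u⁻¹ ^ 2) / 3)) ^ 2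
      - 4 * (conj ((2 * u + u⁻¹ ^ 2) / 3) - ((2 * u + u⁻¹ ^ 2) / 3) ^ 2)
        * ((2 * u + u⁻¹ ^ 2) / 3 - conj ((2 * u + u⁻¹ ^ 2) / 3) ^ 2) = 0 := by
    simp only [map_div₀, map_add, map_mul, map_pow, map_inv₀, hcu, Complex.conj_ofNat, inv_inv]
    field_simp
    ring
  rw [this] at hD
  have h16 : 16 * gdet ((2 * u + u⁻¹ ^ 2) / 3) = 0 := by exact_mod_cast hD
  linarith

lemma curve_eq : curve = {z | gdet z = 0} :=
  Set.Subset.antisymm (fun _ h => gdet_eq_zero_of_mem_curve h) fun _ h => mem_curve_of_gdet_eq_zero h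

lemma zero_notMem_curve : (0 : ℂ) ∈ curveᶜ := by
  rw [curve_eq]
  simp [gdet_eq]

lemma isPreconnected_domain : IsPreconnected domain := isPreconnected_connectedComponentIn

lemma zero_mem_domain : (0 : ℂ) ∈ domain := mem_connectedComponentIn zero_notMem_curve

/-- A continuous function that does not vanish on a preconnected set has constant sign there. -/
lemma pos_of_isPreconnected {X : Type*} [TopologicalSpace X] {s : Set X} (hs : IsPreconnected s)
    {φ : X → ℝ} (hφ : ContinuousOn φ s) (h0 : ∀ x ∈ s, φ x ≠ 0) {a b : X} (ha : a ∈ s)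
    (hpos : 0 < φ a) (hb : b ∈ s) : 0 < φ b := by
  by_contra hneg
  obtain ⟨c, hc, hc0⟩ := hs.intermediate_value hb ha hφ ⟨not_lt.1 hneg, hpos.le⟩
  exact h0 c hc hc0

lemma gdet_pos {z : ℂ} (hz : z ∈ domain) : 0 < gdet z := by
  refine pos_of_isPreconnected isPreconnected_domain continuous_gdet.continuousOn ?_
    zero_mem_domain (by simp [gdet_eq]) hz
  intro w hw h
  exact connectedComponentIn_subset _ _ hw (mem_curve_of_gdet_eq_zero h)

lemma gxx_pos {z : ℂ} (hz : z ∈ domain) : 0 < gxx z := by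
  refine pos_of_isPreconnected isPreconnected_domain ?_ ?_
    zero_mem_domain (by simp [gxx_eq]) hz
  · rw [gxx_eq_quad]
    exact (contDiff_quad _ _ _ _ _ _).continuous.continuousOn
  · intro w hw h
    have := gdet_pos hw
    rw [gdet, h] at this
    nlinarith [sq_nonneg (gxy w)]

lemma gdet_ofReal (x : ℝ) : gdet x = (1 - x) ^ 3 * (1 + 3 * x) / 16 := by
  rw [gdet_eq]; simp; ring

lemma ofReal_mem_domain {x : ℝ} (hx : x ∈ Set.Ioo (-1 / 3 : ℝ) 1) : (x : ℂ) ∈ domain := by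
  have hpre : IsPreconnected ((fun t : ℝ => (t : ℂ)) '' Set.Ioo (-1 / 3 : ℝ) 1) :=
    isPreconnected_Ioo.image _ Complex.continuous_ofReal.continuousOn
  refine hpre.subset_connectedComponentIn ⟨0, by norm_num, by simp⟩ ?_ ⟨x, hx, rfl⟩
  rintro _ ⟨t, ht, rfl⟩ hc
  have h := gdet_eq_zero_of_mem_curve hc
  simp only [gdet_ofReal] at h
  have h1 : 0 < 1 - t := by linarith [ht.2]
  have h2 : 0 < 1 + 3 * t := by linarith [ht.1]
  have : 0 < (1 - t) ^ 3 * (1 + 3 * t) / 16 := by positivity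
  linarith

end Domain

section Optimality

open Filter Topology

/-- `CD(ρ, n)` gives an inequality between jets at the real points of the domain. -/
lemma CD.jet_le {l ρ : ℝ} {n : ℝ≥0∞} (h : CD l ρ n) {x : ℝ} (hx : x ∈ Set.Ioo (-1 / 3 : ℝ) 1)
    (p q a b c : ℝ) :
    ρ * ((1 + 2 * x - 3 * x ^ 2) / 4 * p ^ 2 + (1 - x) ^ 2 / 4 * q ^ 2)
      + (n⁻¹).toReal * jetL l x 0 p q a b c ^ 2 ≤ jetGam2 l x 0 p q a b c := by
  have hf := contDiff_quad 0 (p - a * x) (q - b * x) (a / 2) b (c / 2)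
  have key := h (quad 0 (p - a * x) (q - b * x) (a / 2) b (c / 2))
    ⟨Set.univ, isOpen_univ, Set.subset_univ _, hf.contDiffOn⟩ x (ofReal_mem_domain hx)
  rw [Gam2_eq_jetGam2 isOpen_univ l hf.contDiffOn (Set.mem_univ _), L_eq_jetL, Gam, gxx_eq,
    gxy_eq, gyy_eq] at key
  simp only [dx_quad, dy_quad, quad, Complex.ofReal_re, Complex.ofReal_im] at key
  ring_nf at key ⊢
  exact key

lemma CD.le_of_gradient_x {l ρ : ℝ} {n : ℝ≥0∞} (h : CD l ρ n) (s : ℝ) {x : ℝ}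
    (hx : x ∈ Set.Ioo (-1 / 3 : ℝ) 1) :
    ρ * ((1 + 2 * x - 3 * x ^ 2) / 4) + (n⁻¹).toReal * (s - (l - 1) * x) ^ 2 ≤
      s ^ 2 / 2 + (l - 1) * ((1 + x) / 4) := by
  have h1 : 1 - x ≠ 0 := by linarith [hx.2]
  obtain ⟨r, hr⟩ : ∃ r, r = 1 + 3 * x := ⟨_, rfl⟩
  have h2 : r ≠ 0 := by linarith [hx.1]
  have key := h.jet_le hx 1 0 ((2 * s - 1 + 3 * x) / ((1 - x) * r)) 0
    ((2 * s + 1 + x) / (1 - x) ^ 2)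
  have e1 : jetL l x 0 1 0 ((2 * s - 1 + 3 * x) / ((1 - x) * r)) 0
      ((2 * s + 1 + x) / (1 - x) ^ 2) = s - (l - 1) * x := by
    rw [jetL]; field_simp; rw [hr]; ring
  have e2 : jetGam2 l x 0 1 0 ((2 * s - 1 + 3 * x) / ((1 - x) * r)) 0
      ((2 * s + 1 + x) / (1 - x) ^ 2) = s ^ 2 / 2 + (l - 1) * ((1 + x) / 4) := by
    simp only [jetGam2]; field_simp; rw [hr]; ring
  rw [e1, e2] at key
  linarith

lemma CD.le_of_gradient_y {l ρ : ℝ} {n : ℝ≥0∞} (h : CD l ρ n) {x : ℝ}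
    (hx : x ∈ Set.Ioo (-1 / 3 : ℝ) 1) :
    ρ * ((1 - x) ^ 2 / 4) ≤ (l - 1) * ((1 - x) / 4) := by
  have h1 : 1 - x ≠ 0 := by linarith [hx.2]
  have key := h.jet_le hx 0 1 0 (1 / (1 - x)) 0
  have e1 : jetL l x 0 0 1 0 (1 / (1 - x)) 0 = 0 := by
    rw [jetL]; ring
  have e2 : jetGam2 l x 0 0 1 0 (1 / (1 - x)) 0 = (l - 1) * ((1 - x) / 4) := by
    simp only [jetGam2]; field_simp; ring
  rw [e1, e2] at key
  linarith

/-- The inequality obtained at the cusp `z = 1`. -/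
lemma CD.le_at_cusp {l ρ : ℝ} {n : ℝ≥0∞} (h : CD l ρ n) (s : ℝ) :
    (n⁻¹).toReal * (s - (l - 1)) ^ 2 ≤ s ^ 2 / 2 + (l - 1) / 2 := by
  have hm : Set.Ioo (-1 / 3 : ℝ) 1 ∈ 𝓝[<] (1 : ℝ) := Ioo_mem_nhdsLT (by norm_num)
  have t1 : Tendsto (fun x : ℝ => ρ * ((1 + 2 * x - 3 * x ^ 2) / 4)
      + (n⁻¹).toReal * (s - (l - 1) * x) ^ 2) (𝓝[<] 1)
      (𝓝 (ρ * ((1 + 2 * 1 - 3 * 1 ^ 2) / 4) + (n⁻¹).toReal * (s - (l - 1) * 1) ^ 2)) :=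
    (Continuous.tendsto (by fun_prop) _).mono_left nhdsWithin_le_nhds
  have t2 : Tendsto (fun x : ℝ => s ^ 2 / 2 + (l - 1) * ((1 + x) / 4)) (𝓝[<] 1)
      (𝓝 (s ^ 2 / 2 + (l - 1) * ((1 + 1) / 4))) :=
    (Continuous.tendsto (by fun_prop) _).mono_left nhdsWithin_le_nhds
  have := le_of_tendsto_of_tendsto t1 t2
    (Filter.mem_of_superset hm fun x hx => h.le_of_gradient_x s hx)
  ring_nf at this ⊢
  exact this

/-- The inequality obtained at the boundary point `z = -1/3`. -/
lemma CD.le_three_mul {l ρ : ℝ} {n : ℝ≥0∞} (h : CD l ρ n) : ρ ≤ 3 * (l - 1) / 4 := by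
  have hm : Set.Ioo (-1 / 3 : ℝ) 1 ∈ 𝓝[>] (-1 / 3 : ℝ) := Ioo_mem_nhdsGT (by norm_num)
  have t1 : Tendsto (fun x : ℝ => ρ * ((1 - x) ^ 2 / 4)) (𝓝[>] (-1 / 3))
      (𝓝 (ρ * ((1 - (-1 / 3)) ^ 2 / 4))) :=
    (Continuous.tendsto (by fun_prop) _).mono_left nhdsWithin_le_nhds
  have t2 : Tendsto (fun x : ℝ => (l - 1) * ((1 - x) / 4)) (𝓝[>] (-1 / 3))
      (𝓝 ((l - 1) * ((1 - (-1 / 3)) / 4))) :=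
    (Continuous.tendsto (by fun_prop) _).mono_left nhdsWithin_le_nhds
  have := le_of_tendsto_of_tendsto t1 t2
    (Filter.mem_of_superset hm fun x hx => h.le_of_gradient_y hx)
  linarith

end Optimality

lemma toReal_inv_ofReal_two_mul {l : ℝ} (hl : 0 < l) :
    ((ENNReal.ofReal (2 * l))⁻¹).toReal = (2 * l)⁻¹ := by
  rw [ENNReal.toReal_inv, ENNReal.toReal_ofReal (by positivity)]

lemma CD_three_mul {l : ℝ} (hl : 1 < l) :
    CD l (3 * (l - 1) / 4) (ENNReal.ofReal (2 * l)) := by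
  rintro f ⟨U, hU, hDU, hf⟩ z hz
  have hzU : z ∈ U := hDU (subset_closure hz)
  have hA := gxx_pos hz
  have hD := gdet_pos hz
  rw [gxx_eq] at hA
  rw [gdet_eq] at hD
  have key := curvatureDimension_jet hl (dx f z) (dy f z) (dx (dx f) z) (dx (dy f) z)
    (dy (dy f) z) hA hD
  rw [Gam2_eq_jetGam2 hU l hf hzU, L_eq_jetL, toReal_inv_ofReal_two_mul (by linarith), Gam,
    gxx_eq, gxy_eq, gyy_eq]
  linarith

end Deltoid

theorem mainTheorem1 (l : ℝ) :
    (l < 1 → ∀ ρ : ℝ, ¬ Deltoid.CD l ρ ⊤) ∧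
    (1 < l →
      (∀ n : ENNReal, 1 ≤ n → n < ENNReal.ofReal (2 * l) → ∀ ρ : ℝ, ¬ Deltoid.CD l ρ n) ∧
      IsGreatest {ρ : ℝ | Deltoid.CD l ρ (ENNReal.ofReal (2 * l))} (3 * (l - 1) / 4)) := by
  refine ⟨fun hl ρ h => ?_, fun hl => ⟨fun n hn hnl ρ h => ?_, Deltoid.CD_three_mul hl,
    fun ρ h => Deltoid.CD.le_three_mul h⟩⟩
  · have := h.le_at_cusp 0
    simp at this
    linarith
  · have key := h.le_at_cusp (-1)
    have hlt : (2 * l)⁻¹ < (n⁻¹).toReal := by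
      rw [← Deltoid.toReal_inv_ofReal_two_mul (by linarith)]
      refine (ENNReal.toReal_lt_toReal ?_ ?_).2 (ENNReal.inv_lt_inv.2 hnl)
      · exact ENNReal.inv_ne_top.2 (ne_bot_of_gt hnl)
      · exact ENNReal.inv_ne_top.2 (zero_lt_one.trans_le hn).ne'
    have h1 : (2 * l)⁻¹ * l ^ 2 < (n⁻¹).toReal * l ^ 2 :=
      mul_lt_mul_of_pos_right hlt (by positivity)
    have h2 : (2 * l)⁻¹ * l ^ 2 = l / 2 := by
      have : l ≠ 0 := by positivity
      field_simp
    have h3 : (-1 - (l - 1)) ^ 2 = l ^ 2 := by ring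
    rw [h3] at key
    linarith
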